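/- All graphs are finite and simple. A graph $G=(V,E)$ is a tolerance graph if there are closed real intervals $I_v$ and positive reals $t_v$ ($v\in V$) such that, for distinct $u,v$, $uv\in E$ if and only if $|I_u\cap I_v|\ge\min\{t_u,t_v\}$; it is a bounded tolerance graph if this is possible with $t_v\le|I_v|$ for all $v$. It is a trapezoid graph if it is the intersection graph of trapezoids between two parallel lines. Write $N(u)$ for the set of neighbours of $u$ and $N[u]=N(u)\cup\{u\}$. Let $L_1$ (upper) and $L_2$ (lower) be two parallel lines. A projection representation $R$ of $G$ declares every vertex bounded or unbounded and assigns to every vertex $v$ a parallelogram $P_v$ (possibly a line segment) with two sides on $L_1$ and $L_2$; if $v$ is unbounded, then $P_v$ is a line segment. Let $\phi_v\in(0,\pi)$ be the angle that the other two sides of $P_v$ make with the direction of $L_1,L_2$. It is required that (i) two distinct bounded vertices $u,v$ are adjacent if and only if $P_u\cap P_v\ne\emptyset$; (ii) an unbounded vertex $u$ and a bounded vertex $v$ are adjacent if and only if $P_u\cap P_v\neq\emptyset$ and $\phi_v>\phi_u$; (iii) no two unbounded vertices are adjacent; (iv) endpoints of the parallelograms of distinct vertices are distinct, and so are their slopes.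 Write $P_u\ll_R P_v$ if $P_u$ lies completely to the left of $P_v$. For a vertex $u$, a covering vertex of $u$ is a vertex $v\notin N[u]$ with $N(u)\subseteq N(v)$, and $V_0(u)$ is the set of all vertices lying in a connected component of $G\setminus N[u]$ that contains a covering vertex of $u$. The vertex $u$ has the right (resp. left) border property in $R$ if there are no $w\in N(u)$ and $x\in V_0(u)$ with $P_w\ll_R P_x$ (resp. $P_x\ll_R P_w$). **Theorem.** Let $G$ be a graph that is both a tolerance graph and a trapezoid graph but not a bounded tolerance graph, and that has the smallest number of vertices among all such graphs. Let $R$ be a projection representation of $G$ with exactly $k$ unbounded vertices, and let $u$ be an unbounded vertex in $R$. If $u$ has the right or the left border property in $R$, then there exists a projection representation $R^*$ of $G$ with exactly $k-1$ unbounded vertices. -/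

import Mathlib

open MeasureTheory

namespace TolGraph

/-! ### Trapezoids between two parallel lines -/

/-- A (possibly degenerate) trapezoid between the upper line `L₁ = {y = 1}` and the lower line
`L₂ = {y = 0}`: its lower side is `[l, r]` and its upper side is `[L, R]`. -/
structure Trapezoid where
  /-- lower left endpoint -/
  l : ℝ
  /-- lower right endpoint -/
  r : ℝ
  /-- upper left endpoint -/
  L : ℝ
  /-- upper right endpoint -/
  R : ℝ
  lower_le : l ≤ r
  upper_le : L ≤ R

namespace Trapezoid

/-- The set of points of the trapezoid in the plane. -/
def region (T : Trapezoid) : Set (ℝ × ℝ) :=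
  {p | 0 ≤ p.2 ∧ p.2 ≤ 1 ∧ (1 - p.2) * T.l + p.2 * T.L ≤ p.1 ∧
    p.1 ≤ (1 - p.2) * T.r + p.2 * T.R}

/-- The two trapezoids have a common point. -/
def Meets (S T : Trapezoid) : Prop := (S.region ∩ T.region).Nonempty

/-- `S` lies completely to the left of `T`. -/
def LeftOf (S T : Trapezoid) : Prop := S.r < T.l ∧ S.R < T.L

/-- The left and the right side are parallel. -/
def IsParallelogram (T : Trapezoid) : Prop := T.R - T.L = T.r - T.l

/-- The trapezoid is a line segment from `L₂` to `L₁`. -/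
def IsSegment (T : Trapezoid) : Prop := T.l = T.r ∧ T.L = T.R

/-- The slope of the left side (for a parallelogram, of both lateral sides), measured as the
angle in `(0, π)` that the vector from `(l, 0)` to `(L, 1)` makes with the direction of the
lines `L₁` and `L₂`, i.e. as the arc cotangent of `L - l`. -/
noncomputable def phi (T : Trapezoid) : ℝ := Real.pi / 2 - Real.arctan (T.L - T.l)

/-- Two trapezoids are disjoint exactly when one lies completely to the left of the other. -/
theorem meets_iff (S T : Trapezoid) : S.Meets T ↔ ¬ S.LeftOf T ∧ ¬ T.LeftOf S := by
  constructor
  · rintro ⟨⟨x, y⟩, ⟨h0, h1, h2, h3⟩, ⟨-, -, h4, h5⟩⟩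
    dsimp only at h0 h1 h2 h3 h4 h5
    constructor
    · rintro ⟨ha, hb⟩
      rcases eq_or_lt_of_le h0 with h | h
      · subst h; linarith
      · nlinarith [mul_pos h (sub_pos.2 hb), mul_nonneg (sub_nonneg.2 h1) (sub_pos.2 ha).le]
    · rintro ⟨ha, hb⟩
      rcases eq_or_lt_of_le h0 with h | h
      · subst h; linarith
      · nlinarith [mul_pos h (sub_pos.2 hb), mul_nonneg (sub_nonneg.2 h1) (sub_pos.2 ha).le]
  · rintro ⟨h1, h2⟩
    suffices H : ∃ y : ℝ, 0 ≤ y ∧ y ≤ 1 ∧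
        (1 - y) * S.l + y * S.L ≤ (1 - y) * T.r + y * T.R ∧
        (1 - y) * T.l + y * T.L ≤ (1 - y) * S.r + y * S.R by
      obtain ⟨y, hy0, hy1, hST, hTS⟩ := H
      have hS : (1 - y) * S.l + y * S.L ≤ (1 - y) * S.r + y * S.R := by
        have := S.lower_le; have := S.upper_le
        have : 0 ≤ 1 - y := by linarith
        gcongr
      have hT : (1 - y) * T.l + y * T.L ≤ (1 - y) * T.r + y * T.R := by
        have := T.lower_le; have := T.upper_le
        have : 0 ≤ 1 - y := by linarith
        gcongr
      exact ⟨(max ((1 - y) * S.l + y * S.L) ((1 - y) * T.l + y * T.L), y),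
        ⟨hy0, hy1, le_max_left _ _, max_le hS hTS⟩, ⟨hy0, hy1, le_max_right _ _, max_le hST hT⟩⟩
    simp only [LeftOf, not_and_or, not_lt] at h1 h2
    have key : ∀ A B : Trapezoid, A.l ≤ B.r → B.L ≤ A.R → B.R < A.L → A.r < B.l →
        ∃ y : ℝ, 0 ≤ y ∧ y ≤ 1 ∧
        (1 - y) * A.l + y * A.L ≤ (1 - y) * B.r + y * B.R ∧
        (1 - y) * B.l + y * B.L ≤ (1 - y) * A.r + y * A.R := by
      intro A B _ _ hc hd
      have := A.lower_le; have := B.lower_le; have := A.upper_le; have := B.upper_le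
      have hpos : 0 < (A.L - B.R) + (B.r - A.l) := by linarith
      have e : (1 - (B.r - A.l) / ((A.L - B.R) + (B.r - A.l))) * A.l
          + (B.r - A.l) / ((A.L - B.R) + (B.r - A.l)) * A.L
          = (1 - (B.r - A.l) / ((A.L - B.R) + (B.r - A.l))) * B.r
          + (B.r - A.l) / ((A.L - B.R) + (B.r - A.l)) * B.R := by
        field_simp; ring
      have hy0 : 0 ≤ (B.r - A.l) / ((A.L - B.R) + (B.r - A.l)) :=
        div_nonneg (by linarith) hpos.le
      have hy1 : (B.r - A.l) / ((A.L - B.R) + (B.r - A.l)) ≤ 1 := by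
        rw [div_le_one hpos]; linarith
      generalize (B.r - A.l) / ((A.L - B.R) + (B.r - A.l)) = y at e hy0 hy1
      refine ⟨y, hy0, hy1, e.le, ?_⟩
      nlinarith [mul_le_mul_of_nonneg_left B.lower_le (sub_nonneg.2 hy1),
        mul_le_mul_of_nonneg_left B.upper_le hy0,
        mul_le_mul_of_nonneg_left A.lower_le (sub_nonneg.2 hy1),
        mul_le_mul_of_nonneg_left A.upper_le hy0]
    by_cases hl : S.l ≤ T.r ∧ T.l ≤ S.r
    · exact ⟨0, le_rfl, zero_le_one, by simpa using hl.1, by simpa using hl.2⟩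
    by_cases hu : S.L ≤ T.R ∧ T.L ≤ S.R
    · exact ⟨1, zero_le_one, le_rfl, by simpa using hu.1, by simpa using hu.2⟩
    have := S.lower_le; have := T.lower_le; have := S.upper_le; have := T.upper_le
    rw [not_and_or, not_le, not_le] at hl hu
    rcases hl with hl | hl <;> rcases hu with hu | hu
    · exfalso; rcases h2 with h | h <;> linarith
    · obtain ⟨y, h, h', ha, hb⟩ := key T S (by linarith) (by linarith) hu hl
      exact ⟨y, h, h', hb, ha⟩
    · exact key S T (by linarith) (by linarith) hu hl
    · exfalso; rcases h1 with h | h <;> linarith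

end Trapezoid

/-! ### Graph classes -/

/-- A tolerance representation of `G`: closed intervals `[a v, b v]` and positive tolerances
`t v`, such that distinct `u`, `v` are adjacent exactly when the length of the intersection of
their intervals is at least the minimum of their tolerances. -/
structure ToleranceRep {V : Type*} (G : SimpleGraph V) where
  a : V → ℝ
  b : V → ℝ
  t : V → ℝ
  le : ∀ v, a v ≤ b v
  pos : ∀ v, 0 < t v
  adj_iff : ∀ u v, u ≠ v →
    (G.Adj u v ↔
      min (t u) (t v) ≤ volume.real (Set.Icc (a u) (b u) ∩ Set.Icc (a v) (b v)))

/-- Tolerance graphs. -/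
def IsTolerance {V : Type*} (G : SimpleGraph V) : Prop := Nonempty (ToleranceRep G)

/-- Bounded tolerance graphs: some tolerance representation has only bounded vertices, i.e. each
tolerance is at most the length of the interval. -/
def IsBoundedTolerance {V : Type*} (G : SimpleGraph V) : Prop :=
  ∃ I : ToleranceRep G, ∀ v, I.t v ≤ I.b v - I.a v

/-- Trapezoid graphs: intersection graphs of trapezoids between two parallel lines. -/
def IsTrapezoid {V : Type*} (G : SimpleGraph V) : Prop :=
  ∃ T : V → Trapezoid, ∀ u v, u ≠ v → (G.Adj u v ↔ (T u).Meets (T v))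

/-! ### Projection representations -/

/-- A projection representation of `G`: every vertex is assigned a parallelogram between the two
parallel lines and is either bounded or unbounded; parallelograms of unbounded vertices are line
segments. All endpoints and all slopes belonging to distinct vertices are distinct. -/
structure ProjectionRep {V : Type*} (G : SimpleGraph V) where
  /-- the parallelogram of a vertex -/
  P : V → Trapezoid
  /-- the set of unbounded vertices -/
  unbounded : Set V
  isParallelogram : ∀ v, (P v).IsParallelogram
  isSegment : ∀ v ∈ unbounded, (P v).IsSegment
  adj_bounded : ∀ u v, u ∉ unbounded → v ∉ unbounded → u ≠ v →
    (G.Adj u v ↔ (P u).Meets (P v))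
  adj_mixed : ∀ u v, u ∈ unbounded → v ∉ unbounded →
    (G.Adj u v ↔ (P u).Meets (P v) ∧ (P u).phi < (P v).phi)
  not_adj_unbounded : ∀ u v, u ∈ unbounded → v ∈ unbounded → ¬ G.Adj u v
  lower_distinct : ∀ u v, u ≠ v →
    (P u).l ≠ (P v).l ∧ (P u).l ≠ (P v).r ∧ (P u).r ≠ (P v).r
  upper_distinct : ∀ u v, u ≠ v →
    (P u).L ≠ (P v).L ∧ (P u).L ≠ (P v).R ∧ (P u).R ≠ (P v).R
  phi_distinct : ∀ u v, u ≠ v → (P u).phi ≠ (P v).phi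

/-! ### Covering vertices and the border properties -/

/-- The closed neighbourhood `N[u]`. -/
def closedNbhd {V : Type*} (G : SimpleGraph V) (u : V) : Set V := insert u (G.neighborSet u)

/-- The covering set of `u`: vertices `v ∉ N[u]` with `N(u) ⊆ N(v)`. -/
def coveringSet {V : Type*} (G : SimpleGraph V) (u : V) : Set V :=
  {v | v ∉ closedNbhd G u ∧ G.neighborSet u ⊆ G.neighborSet v}

/-- The connected components of `G \ N[u]` that contain a covering vertex of `u`. -/
def V0Components {V : Type*} (G : SimpleGraph V) (u : V) :
    Set (G.induce (closedNbhd G u)ᶜ).ConnectedComponent :=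
  {C | ∃ v ∈ C.supp, (v : V) ∈ coveringSet G u}

/-- The set of all vertices lying in a component of `V0Components G u`. -/
def V0 {V : Type*} (G : SimpleGraph V) (u : V) : Set V :=
  {x | ∃ C ∈ V0Components G u, ∃ y ∈ C.supp, (y : V) = x}

/-- The right border property of `u` in `R`. -/
def RightBorder {V : Type*} {G : SimpleGraph V} (R : ProjectionRep G) (u : V) : Prop :=
  ¬ ∃ w ∈ G.neighborSet u, ∃ x ∈ V0 G u, (R.P w).LeftOf (R.P x)

/-- The left border property of `u` in `R`. -/
def LeftBorder {V : Type*} {G : SimpleGraph V} (R : ProjectionRep G) (u : V) : Prop :=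
  ¬ ∃ w ∈ G.neighborSet u, ∃ x ∈ V0 G u, (R.P x).LeftOf (R.P w)

end TolGraph

namespace TolGraph

/-! ### Strip representations -/

/-! Only a nonadjacent vertex whose parallelogram meets `P_u` and has larger slope (smaller angle)
than `P_u` obstructs declaring `u` bounded; such a vertex is said to hover over `u`. If none exists,
the representation stays as it is (`exists_of_no_hovers`).

A vertex hovering over `u` is adjacent to all of `N(u)`, hence covers `u`. By minimality `G - u` is
a parallelogram graph. If two covering vertices lay in different components of `G \ N[u]`, all of
`N(u)` would span the gap beside one of these components, and `u` could be inserted there as a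
segment, making `G` a bounded tolerance graph. So all covering vertices lie in a single component
`C` (`mem_of_covering`).

Consequently a vertex outside `C ∪ N[u]` that meets `C ∪ {u}` is unbounded and has smaller slope
than what it meets (`crossing`), while a bounded one lies entirely on one side (`one_sided`). Under
the right border property, `u` is redrawn as a segment just right of the largest lower and the
largest upper left endpoint in `C ∪ {u}`. Using left endpoints allows the parallelograms of `C` to
be cut back to that segment without becoming negative in width. Neighbours of `u` are extended until
they reach it. These changes preserve all adjacencies, and `u` may now be bounded
(`exists_of_right_border`). The left border property follows by rotation. Strip representations
ignore coincident endpoints; a final perturbation separates them. -/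

/-- The parallelogram with lower side `[l a, l a + w a]` and upper side `[L a, L a + w a]` lies
completely to the left of the one of `b`. -/
def StripLt {V : Type*} (l L w : V → ℝ) (a b : V) : Prop :=
  l a + w a < l b ∧ L a + w a < L b

/-- A projection representation in coordinates, without the requirement that endpoints are
distinct. The parallelogram of `v` has lower side `[l v, l v + w v]` and upper side
`[L v, L v + w v]`. -/
structure StripRep {V : Type*} (G : SimpleGraph V) where
  l : V → ℝ
  L : V → ℝ
  w : V → ℝ
  U : Set V
  w_nonneg : ∀ v, 0 ≤ w v
  w_eq_zero : ∀ v ∈ U, w v = 0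
  adj_bounded : ∀ a b, a ∉ U → b ∉ U → a ≠ b →
    (G.Adj a b ↔ ¬ StripLt l L w a b ∧ ¬ StripLt l L w b a)
  adj_mixed : ∀ x b, x ∈ U → b ∉ U →
    (G.Adj x b ↔ (¬ StripLt l L w x b ∧ ¬ StripLt l L w b x) ∧ L b - l b < L x - l x)
  indep : ∀ x y, x ∈ U → y ∈ U → ¬ G.Adj x y
  slope_ne : ∀ a b, a ≠ b → L a - l a ≠ L b - l b

namespace StripRep

variable {V : Type*} {G : SimpleGraph V}

/-- `a` lies completely to the left of `b`. -/
def Lt (S : StripRep G) (a b : V) : Prop := StripLt S.l S.L S.w a b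

/-- The horizontal displacement from the lower to the upper end of the lateral sides. -/
def slope (S : StripRep G) (a : V) : ℝ := S.L a - S.l a

/-- `x` is not adjacent to `u` although its parallelogram meets the one of `u`, because it leans
further to the right. -/
def Hovers (S : StripRep G) (x u : V) : Prop :=
  ¬ G.Adj u x ∧ ¬ S.Lt u x ∧ ¬ S.Lt x u ∧ S.slope u < S.slope x

/-- Left endpoints differ from all endpoints of other vertices. -/
def Generic (S : StripRep G) : Prop :=
  ∀ a b, a ≠ b → S.l a ≠ S.l b ∧ S.l a ≠ S.l b + S.w b ∧ S.L a ≠ S.L b ∧ S.L a ≠ S.L b + S.w b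

/-- Rotation by a straight angle. -/
def rotate (S : StripRep G) : StripRep G where
  l v := -(S.L v + S.w v)
  L v := -(S.l v + S.w v)
  w := S.w
  U := S.U
  w_nonneg := S.w_nonneg
  w_eq_zero := S.w_eq_zero
  adj_bounded a b ha hb hab := by
    rw [S.adj_bounded a b ha hb hab]
    simp only [StripLt, neg_add_rev, neg_add_cancel_comm]
    constructor <;> rintro ⟨h1, h2⟩ <;> refine ⟨fun h => h2 ⟨?_, ?_⟩, fun h => h1 ⟨?_, ?_⟩⟩ <;>
      linarith [h.1, h.2]
  adj_mixed a b ha hb := by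
    rw [S.adj_mixed a b ha hb]
    simp only [StripLt]
    have := S.w_eq_zero a ha
    constructor <;> rintro ⟨⟨h1, h2⟩, h3⟩ <;>
      refine ⟨⟨fun h => h2 ⟨?_, ?_⟩, fun h => h1 ⟨?_, ?_⟩⟩, ?_⟩ <;>
      first | linarith [h.1, h.2] | linarith
  indep := S.indep
  slope_ne a b hab h := S.slope_ne a b hab (by linarith)

theorem rotate_lt (S : StripRep G) (a b : V) : S.rotate.Lt a b ↔ S.Lt b a := by
  simp only [Lt, StripLt, rotate]
  constructor <;> rintro ⟨h1, h2⟩ <;> constructor <;> linarith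

theorem rotate_slope (S : StripRep G) (a : V) : S.rotate.slope a = S.slope a := by
  simp only [slope, rotate]; ring

theorem rotate_hovers (S : StripRep G) {x u : V} (h : S.Hovers x u) : S.rotate.Hovers x u := by
  simp only [Hovers, rotate_lt, rotate_slope] at *
  exact ⟨h.1, h.2.2.1, h.2.1, h.2.2.2⟩

/-! ### Passage between projection representations and strip coordinates. -/

section Conversion

theorem phi_lt_iff (S T : Trapezoid) : S.phi < T.phi ↔ T.L - T.l < S.L - S.l := by
  unfold Trapezoid.phi
  rw [sub_lt_sub_iff_left]
  exact Real.arctan_strictMono.lt_iff_lt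

theorem phi_ne_iff (S T : Trapezoid) : S.phi ≠ T.phi ↔ S.L - S.l ≠ T.L - T.l := by
  unfold Trapezoid.phi
  rw [ne_eq, sub_right_inj]
  exact Real.arctan_injective.eq_iff.not

/-- The coordinates of a projection representation. -/
noncomputable def ofProjectionRep (R : ProjectionRep G) : StripRep G where
  l v := (R.P v).l
  L v := (R.P v).L
  w v := (R.P v).r - (R.P v).l
  U := R.unbounded
  w_nonneg v := by linarith [(R.P v).lower_le]
  w_eq_zero v hv := by linarith [(R.isSegment v hv).1]
  adj_bounded a b ha hb hab := by
    rw [R.adj_bounded a b ha hb hab, Trapezoid.meets_iff]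
    have h1 := R.isParallelogram a
    have h2 := R.isParallelogram b
    unfold Trapezoid.IsParallelogram at h1 h2
    simp only [StripLt, Trapezoid.LeftOf, ← h1, ← h2, add_sub_cancel]
    simp only [h1, h2, add_sub_cancel]
  adj_mixed a b ha hb := by
    rw [R.adj_mixed a b ha hb, Trapezoid.meets_iff, phi_lt_iff]
    have h1 := R.isParallelogram a
    have h2 := R.isParallelogram b
    unfold Trapezoid.IsParallelogram at h1 h2
    simp only [StripLt, Trapezoid.LeftOf, ← h1, ← h2, add_sub_cancel]
    simp only [h1, h2, add_sub_cancel]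
  indep := R.not_adj_unbounded
  slope_ne a b hab := (phi_ne_iff _ _).1 (R.phi_distinct a b hab)

theorem ofProjectionRep_lt (R : ProjectionRep G) (a b : V) :
    (ofProjectionRep R).Lt a b ↔ (R.P a).LeftOf (R.P b) := by
  have h1 := R.isParallelogram a
  unfold Trapezoid.IsParallelogram at h1
  simp only [Lt, StripLt, Trapezoid.LeftOf, ofProjectionRep, add_sub_cancel]
  rw [← h1, add_sub_cancel]

theorem ofProjectionRep_generic (R : ProjectionRep G) : (ofProjectionRep R).Generic := by
  intro a b hab
  have h2 := R.isParallelogram b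
  unfold Trapezoid.IsParallelogram at h2
  have h3 := R.lower_distinct a b hab
  have h4 := R.upper_distinct a b hab
  simp only [ofProjectionRep, add_sub_cancel]
  rw [← h2, add_sub_cancel]
  exact ⟨h3.1, h3.2.1, h4.1, h4.2.1⟩

theorem ofProjectionRep_rotate_generic (R : ProjectionRep G) :
    (ofProjectionRep R).rotate.Generic := by
  intro a b hab
  have h1 := R.isParallelogram a
  have h2 := R.isParallelogram b
  unfold Trapezoid.IsParallelogram at h1 h2
  have h3 := R.lower_distinct a b hab
  have h4 := R.upper_distinct a b hab
  have h5 := (R.lower_distinct b a hab.symm).2.1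
  have h6 := (R.upper_distinct b a hab.symm).2.1
  simp only [ofProjectionRep, rotate]
  refine ⟨fun h => h4.2.2 ?_, fun h => h6 ?_, fun h => h3.2.2 ?_, fun h => h5 ?_⟩ <;> linarith

open Filter Topology in
/-- A strip representation can be perturbed to a projection representation. -/
theorem exists_projectionRep [Finite V] (S : StripRep G) :
    ∃ R : ProjectionRep G, R.unbounded = S.U := by
  classical
  obtain ⟨n, ⟨φ⟩⟩ := Finite.exists_equiv_fin V
  -- distinct positive weights, larger for bounded vertices
  obtain ⟨e, he0, heinj, heU⟩ : ∃ e : V → ℝ, (∀ v, 0 < e v) ∧ (∀ a b, a ≠ b → e a ≠ e b) ∧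
      ∀ x b, x ∈ S.U → b ∉ S.U → e x < e b := by
    refine ⟨fun v => (φ v : ℕ) + 1 + if v ∈ S.U then 0 else (n : ℝ), fun v => ?_,
      fun a b hab h => ?_, fun x b hx hb => ?_⟩
    · dsimp only; split_ifs <;> positivity
    · have ha : ((φ a : ℕ) : ℝ) < n := by exact_mod_cast (φ a).2
      have hb : ((φ b : ℕ) : ℝ) < n := by exact_mod_cast (φ b).2
      have ha0 : (0 : ℝ) ≤ ((φ a : ℕ) : ℝ) := by positivity
      have hb0 : (0 : ℝ) ≤ ((φ b : ℕ) : ℝ) := by positivity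
      have key : ((φ a : ℕ) : ℝ) = (φ b : ℕ) := by
        dsimp only at h
        split_ifs at h <;> linarith
      exact hab (φ.injective (Fin.ext (by exact_mod_cast key)))
    · have ha : ((φ x : ℕ) : ℝ) < n := by exact_mod_cast (φ x).2
      have hb0 : (0 : ℝ) ≤ ((φ b : ℕ) : ℝ) := by positivity
      simp only [hx, hb, if_true, if_false]
      linarith
  -- left and right shifts
  let p : V → ℝ := fun v => if v ∈ S.U then e v else -e v
  have hp_abs : ∀ v, p v ≤ e v := by
    intro v; dsimp only [p]; split_ifs <;> linarith [he0 v]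
  have hpe : ∀ a b, a ≠ b → p a ≠ e b := by
    intro a b hab
    dsimp only [p]
    split_ifs
    · exact heinj a b hab
    · linarith [he0 a, he0 b]
  have hpp : ∀ a b, a ≠ b → p a ≠ p b := by
    intro a b hab h
    have := he0 a; have := he0 b
    dsimp only [p] at h
    split_ifs at h
    · exact heinj a b hab h
    · linarith
    · linarith
    · exact heinj a b hab (by linarith)
  have line_ne : ∀ x y c d : ℝ, c ≠ d → ∀ᶠ t in 𝓝[>] (0 : ℝ), x + t * c ≠ y + t * d := by
    intro x y c d hcd
    have hcd' : c - d ≠ 0 := sub_ne_zero.2 hcd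
    by_cases h0 : (y - x) / (c - d) = 0
    · filter_upwards [self_mem_nhdsWithin] with t ht h
      have ht : 0 < t := ht
      have : (y - x) / (c - d) = t := by rw [div_eq_iff hcd']; linarith
      linarith
    · have : ∀ᶠ t in 𝓝[>] (0 : ℝ), t ≠ (y - x) / (c - d) :=
        (eventually_ne_nhds (Ne.symm h0)).filter_mono nhdsWithin_le_nhds
      filter_upwards [this] with t ht h
      exact ht (by rw [eq_div_iff hcd']; linarith)
  have line_lt : ∀ x y c d : ℝ, x < y → ∀ᶠ t in 𝓝[>] (0 : ℝ), x + t * c < y + t * d := by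
    intro x y c d hxy
    have h1 : Tendsto (fun t : ℝ => x + t * c) (𝓝 0) (𝓝 x) := by
      have : Continuous fun t : ℝ => x + t * c := by fun_prop
      simpa using this.tendsto 0
    have h2 : Tendsto (fun t : ℝ => y + t * d) (𝓝 0) (𝓝 y) := by
      have : Continuous fun t : ℝ => y + t * d := by fun_prop
      simpa using this.tendsto 0
    exact (h1.eventually_lt h2 hxy).filter_mono nhdsWithin_le_nhds
  -- Each endpoint moves linearly in `t`, with different coefficients for the endpoints compared, so
  -- a coincidence occurs for at most one `t`; strict separations survive for small `t`.
  have hE : ∀ᶠ t in 𝓝[>] (0 : ℝ), 0 < t ∧ ∀ a b, a ≠ b →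
      ((S.l a + t * p a ≠ S.l b + t * p b ∧ S.l a + t * p a ≠ (S.l b + S.w b) + t * e b ∧
        (S.l a + S.w a) + t * e a ≠ (S.l b + S.w b) + t * e b) ∧
      (S.L a + t * p a ≠ S.L b + t * p b ∧ S.L a + t * p a ≠ (S.L b + S.w b) + t * e b ∧
        (S.L a + S.w a) + t * e a ≠ (S.L b + S.w b) + t * e b)) ∧
      (S.Lt a b → (S.l a + S.w a) + t * e a < S.l b + t * p b ∧
        (S.L a + S.w a) + t * e a < S.L b + t * p b) := by
    refine Eventually.and (show ∀ᶠ t in 𝓝[>] (0 : ℝ), 0 < t from self_mem_nhdsWithin) ?_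
    rw [eventually_all]; intro a
    rw [eventually_all]; intro b
    by_cases hab : a = b
    · simp [hab]
    simp only [ne_eq, hab, not_false_eq_true, true_imp_iff]
    refine ((((line_ne _ _ _ _ (hpp a b hab)).and ((line_ne _ _ _ _ (hpe a b hab)).and
      (line_ne _ _ _ _ (heinj a b hab)))).and ((line_ne _ _ _ _ (hpp a b hab)).and
      ((line_ne _ _ _ _ (hpe a b hab)).and (line_ne _ _ _ _ (heinj a b hab)))))).and ?_
    by_cases h : S.Lt a b
    · simp only [h, true_imp_iff]
      exact (line_lt _ _ _ _ h.1).and (line_lt _ _ _ _ h.2)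
    · simp [h]
  obtain ⟨t, ht0, ht⟩ := hE.exists
  let P : V → Trapezoid := fun v =>
    { l := S.l v + t * p v
      r := (S.l v + S.w v) + t * e v
      L := S.L v + t * p v
      R := (S.L v + S.w v) + t * e v
      lower_le := by nlinarith [S.w_nonneg v, hp_abs v]
      upper_le := by nlinarith [S.w_nonneg v, hp_abs v] }
  have hLt : ∀ a b, a ≠ b → S.Lt a b → (P a).LeftOf (P b) := fun a b hab h => (ht a b hab).2 h
  have hLt' : ∀ a b, (a ∉ S.U ∨ b ∉ S.U) → (P a).LeftOf (P b) → S.Lt a b := by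
    intro a b hab h
    have h1 : (S.l a + S.w a) + t * e a < S.l b + t * p b := h.1
    have h2 : (S.L a + S.w a) + t * e a < S.L b + t * p b := h.2
    -- No new separation arises: bounded parallelograms grow on both sides, and a segment moves
    -- right by less than any bounded one grows.
    have : p b ≤ e a := by
      dsimp only [p]
      split_ifs with hb
      · exact (heU b a hb (hab.resolve_right (not_not.2 hb))).le
      · linarith [he0 a, he0 b]
    have := mul_le_mul_of_nonneg_left this ht0.le
    exact ⟨by linarith, by linarith⟩
  refine ⟨⟨P, S.U, fun v => ?_, fun v hv => ?_, fun a b ha hb hab => ?_, fun a b ha hb => ?_,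
    S.indep, fun a b hab => (ht a b hab).1.1, fun a b hab => (ht a b hab).1.2,
    fun a b hab => ?_⟩, rfl⟩
  · simp only [Trapezoid.IsParallelogram, P]; ring
  · simp [Trapezoid.IsSegment, P, p, hv, S.w_eq_zero v hv]
  · rw [S.adj_bounded a b ha hb hab, Trapezoid.meets_iff]
    exact ⟨fun h => ⟨fun h' => h.1 (hLt' a b (Or.inl ha) h'),
      fun h' => h.2 (hLt' b a (Or.inl hb) h')⟩,
      fun h => ⟨fun h' => h.1 (hLt a b hab h'), fun h' => h.2 (hLt b a hab.symm h')⟩⟩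
  · have hab : a ≠ b := fun h => hb (h ▸ ha)
    rw [S.adj_mixed a b ha hb, Trapezoid.meets_iff, phi_lt_iff]
    refine and_congr ?_ ?_
    · exact ⟨fun h => ⟨fun h' => h.1 (hLt' a b (Or.inr hb) h'),
        fun h' => h.2 (hLt' b a (Or.inl hb) h')⟩,
        fun h => ⟨fun h' => h.1 (hLt a b hab h'), fun h' => h.2 (hLt b a hab.symm h')⟩⟩
    · simp [P]
  · rw [phi_ne_iff]
    simpa [P] using S.slope_ne a b hab

end Conversion

end StripRep

end TolGraph

/-! ### Covering components, slopes and hovering vertices. -/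

namespace TolGraph

/-- `C` is a connected component of `G \ N[u]` that contains every covering vertex of `u`. -/
structure IsCoveringComponent {V : Type*} (G : SimpleGraph V) (u : V) (C : Set V) : Prop where
  ne : ∀ c ∈ C, c ≠ u
  not_adj : ∀ c ∈ C, ¬ G.Adj u c
  closed : ∀ c ∈ C, ∀ d, d ≠ u → ¬ G.Adj u d → G.Adj c d → d ∈ C
  connected : ∀ P : Set V, P ⊆ C → P.Nonempty →
    (∀ a ∈ P, ∀ b ∈ C, G.Adj a b → b ∈ P) → P = C
  covering : ∀ x, x ≠ u → ¬ G.Adj u x → (∀ y, G.Adj u y → G.Adj x y) → x ∈ C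

namespace StripRep

variable {V : Type*} {G : SimpleGraph V} (S : StripRep G)

theorem Lt.trans {S : StripRep G} {a b c : V} (h1 : S.Lt a b) (h2 : S.Lt b c) : S.Lt a c :=
  ⟨by linarith [h1.1, h2.1, S.w_nonneg b], by linarith [h1.2, h2.2, S.w_nonneg b]⟩

theorem not_lt_of_adj {a b : V} (h : G.Adj a b) : ¬ S.Lt a b := by
  by_cases ha : a ∈ S.U
  · by_cases hb : b ∈ S.U
    · exact absurd h (S.indep a b ha hb)
    · exact ((S.adj_mixed a b ha hb).1 h).1.1
  · by_cases hb : b ∈ S.U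
    · exact ((S.adj_mixed b a hb ha).1 h.symm).1.2
    · exact ((S.adj_bounded a b ha hb h.ne).1 h).1

theorem not_mem_of_adj {x y : V} (hx : x ∈ S.U) (h : G.Adj x y) : y ∉ S.U :=
  fun hy => S.indep x y hx hy h

theorem slope_lt_of_adj {x y : V} (hx : x ∈ S.U) (h : G.Adj x y) : S.slope y < S.slope x :=
  ((S.adj_mixed x y hx (S.not_mem_of_adj hx h)).1 h).2

/-- A segment reaches from the lower side to the upper side of a parallelogram that it meets and
that leans further to the left. -/
theorem le_of_slope_lt {x y : V} (hx : S.w x = 0) (h1 : ¬ S.Lt x y) (h2 : ¬ S.Lt y x)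
    (h : S.slope y < S.slope x) : S.l x ≤ S.l y + S.w y ∧ S.L y ≤ S.L x := by
  simp only [slope] at h
  simp only [Lt, StripLt, not_and_or, not_lt, hx, add_zero] at h1 h2
  constructor
  · rcases h2 with h2 | h2 <;> linarith
  · rcases h1 with h1 | h1 <;> linarith

theorem le_of_lt_slope {x y : V} (hx : S.w x = 0) (h1 : ¬ S.Lt x y) (h2 : ¬ S.Lt y x)
    (h : S.slope x < S.slope y) : S.l y ≤ S.l x ∧ S.L x ≤ S.L y + S.w y := by
  simp only [slope] at h
  simp only [Lt, StripLt, not_and_or, not_lt, hx, add_zero] at h1 h2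
  constructor
  · rcases h1 with h1 | h1 <;> linarith
  · rcases h2 with h2 | h2 <;> linarith

/-- Adjacent vertices of an unbounded vertex are adjacent to the vertices hovering over it. -/
theorem adj_of_slope_lt {x z y : V} (hx : x ∈ S.U) (h1 : ¬ S.Lt x z) (h2 : ¬ S.Lt z x)
    (h : S.slope x < S.slope z) (hy : G.Adj x y) : G.Adj z y := by
  have hyU := S.not_mem_of_adj hx hy
  have hs := S.slope_lt_of_adj hx hy
  have hzy : z ≠ y := by rintro rfl; linarith
  obtain ⟨a1, a2⟩ := S.le_of_slope_lt (S.w_eq_zero x hx) (S.not_lt_of_adj hy)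
    (S.not_lt_of_adj hy.symm) hs
  obtain ⟨b1, b2⟩ := S.le_of_lt_slope (S.w_eq_zero x hx) h1 h2 h
  have c1 : ¬ S.Lt z y := fun h => by linarith [h.2]
  have c2 : ¬ S.Lt y z := fun h => by linarith [h.1]
  by_cases hz : z ∈ S.U
  · exact (S.adj_mixed z y hz hyU).2 ⟨⟨c1, c2⟩, hs.trans h⟩
  · exact (S.adj_bounded z y hz hyU hzy).2 ⟨c1, c2⟩

theorem slope_lt_of_not_adj {x z : V} (hx : x ∈ S.U) (hz : z ∉ S.U) (h1 : ¬ S.Lt x z)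
    (h2 : ¬ S.Lt z x) (h : ¬ G.Adj x z) : S.slope x < S.slope z := by
  have hne : x ≠ z := by rintro rfl; exact hz hx
  refine lt_of_le_of_ne (not_lt.1 fun hlt => h ?_) (S.slope_ne x z hne)
  exact (S.adj_mixed x z hx hz).2 ⟨⟨h1, h2⟩, hlt⟩

/-- Hovering forces `N(u) ⊆ N(x)`, so `x` is a covering vertex of `u`. -/
theorem mem_of_hovers {u x : V} {C : Set V} (hC : IsCoveringComponent G u C) (hu : u ∈ S.U)
    (h : S.Hovers x u) : x ∈ C :=
  hC.covering x (by rintro rfl; exact lt_irrefl _ h.2.2.2) h.1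
    fun _ hy => S.adj_of_slope_lt hu h.2.1 h.2.2.1 h.2.2.2 hy

/-- If nothing hovers over `u`, then `u` can be declared bounded. -/
theorem exists_of_no_hovers {u : V} (hu : u ∈ S.U) (h : ∀ x, ¬ S.Hovers x u) :
    ∃ S' : StripRep G, S'.U = S.U \ {u} := by
  have key : ∀ v, v ≠ u → ¬ G.Adj u v → ¬ S.Lt u v → ¬ S.Lt v u → S.slope v < S.slope u := by
    intro v hv hadj h1 h2
    refine lt_of_le_of_ne (not_lt.1 fun hlt => h v ⟨hadj, h1, h2, hlt⟩) (S.slope_ne v u hv)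
  have keyb : ∀ v, v ∉ S.U → (G.Adj u v ↔ ¬ S.Lt u v ∧ ¬ S.Lt v u) := by
    intro v hv
    refine ⟨fun hadj => ⟨S.not_lt_of_adj hadj, S.not_lt_of_adj hadj.symm⟩, fun ⟨h1, h2⟩ => ?_⟩
    by_contra hadj
    have hne : v ≠ u := by rintro rfl; exact hv hu
    exact hadj ((S.adj_mixed u v hu hv).2 ⟨⟨h1, h2⟩, key v hne hadj h1 h2⟩)
  refine ⟨⟨S.l, S.L, S.w, S.U \ {u}, S.w_nonneg, fun v hv => S.w_eq_zero v hv.1,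
    fun a b ha hb hab => ?_, fun x b hx hb => ?_, fun x y hx hy => S.indep x y hx.1 hy.1,
    S.slope_ne⟩, rfl⟩
  · simp only [Set.mem_sdiff, Set.mem_singleton_iff, not_and_or, not_not] at ha hb
    by_cases hau : a = u
    · subst hau
      exact keyb b (hb.resolve_right (Ne.symm hab))
    · by_cases hbu : b = u
      · subst hbu
        rw [G.adj_comm, and_comm]
        exact keyb a (ha.resolve_right hau)
      · exact S.adj_bounded a b (ha.resolve_right hau) (hb.resolve_right hbu) hab
  · simp only [Set.mem_sdiff, Set.mem_singleton_iff, not_and_or, not_not] at hx hb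
    by_cases hbu : b = u
    · subst hbu
      have hna := S.indep x b hx.1 hu
      refine iff_of_false hna fun ⟨⟨h1, h2⟩, h3⟩ => ?_
      have := key x hx.2 (fun h => hna h.symm) h2 h1
      exact lt_asymm this h3
    · exact S.adj_mixed x b hx.1 (hb.resolve_right hbu)

/-! ### Vertices outside `C ∪ N[u]` relative to `C`. -/

section Component

variable {S} {u h₀ : V} {C : Set V} (hC : IsCoveringComponent G u C) (hu : u ∈ S.U)
  (h₀C : h₀ ∈ C) (hh : S.Hovers h₀ u)

include hC hu h₀C hh

/-- An unbounded vertex of `C` over which a vertex outside of `C` leans further to the right does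
not exist. -/
theorem not_slope_lt_of_mem {c d : V} (hc : c ∈ C) (hcU : c ∈ S.U) (hdC : d ∉ C) (hdu : d ≠ u)
    (hud : ¬ G.Adj u d) (h1 : ¬ S.Lt c d) (h2 : ¬ S.Lt d c) : ¬ S.slope c < S.slope d := by
  intro h
  have hN : ∀ y, G.Adj c y → G.Adj d y := fun y hy => S.adj_of_slope_lt hcU h1 h2 h hy
  -- A neighbour of `c` in `C` would be adjacent to `d` and pull `d` into `C`. So `c` is isolated in
  -- `C`, hence equals `h₀`, and `N(u) ⊆ N(h₀) ⊆ N(d)` makes `d` a covering vertex outside `C`.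
  have hsing : ({c} : Set V) = C := by
    refine hC.connected {c} (by simpa using hc) ⟨c, rfl⟩ ?_
    rintro a rfl b hb hab
    exact absurd (hC.closed b hb d hdu hud (hN b hab).symm) hdC
  obtain rfl : h₀ = c := by simpa [← hsing] using h₀C
  exact hdC (hC.covering d hdu hud fun y hy =>
    hN y (S.adj_of_slope_lt hu hh.2.1 hh.2.2.1 hh.2.2.2 hy))

/-- Since `c` and `d` are nonadjacent but meet, one of them is unbounded. If `d` had the larger
slope, `c` would be unbounded, and `d` would hover over `u` or contradict `not_slope_lt_of_mem`. -/
theorem crossing {c d : V} (hc : c ∈ insert u C) (hdC : d ∉ C) (hdu : d ≠ u)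
    (hud : ¬ G.Adj u d) (h1 : ¬ S.Lt c d) (h2 : ¬ S.Lt d c) :
    d ∈ S.U ∧ S.slope d < S.slope c := by
  have hcd : c ≠ d := by
    rintro rfl
    rcases hc with rfl | hc
    · exact hdu rfl
    · exact hdC hc
  have hna : ¬ G.Adj c d := by
    rcases hc with rfl | hc
    · exact hud
    · exact fun h => hdC (hC.closed c hc d hdu hud h)
  have hslope : S.slope d < S.slope c := by
    refine lt_of_le_of_ne (not_lt.1 fun hlt => ?_) (S.slope_ne d c hcd.symm)
    have hcU : c ∈ S.U := by
      by_contra hcU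
      by_cases hdU : d ∈ S.U
      · exact lt_asymm hlt (S.slope_lt_of_not_adj hdU hcU h2 h1 fun h => hna h.symm)
      · exact hna ((S.adj_bounded c d hcU hdU hcd).2 ⟨h1, h2⟩)
    rcases hc with rfl | hc
    · exact hdC (S.mem_of_hovers hC hcU ⟨hud, h1, h2, hlt⟩)
    · exact not_slope_lt_of_mem hC hu h₀C hh hc hcU hdC hdu hud h1 h2 hlt
  refine ⟨?_, hslope⟩
  by_contra hdU
  by_cases hcU : c ∈ S.U
  · exact lt_asymm hslope (S.slope_lt_of_not_adj hcU hdU h1 h2 hna)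
  · exact hna ((S.adj_bounded c d hcU hdU hcd).2 ⟨h1, h2⟩)

/-- By `crossing`, `d` meets nothing in `C ∪ {u}`. Adjacent vertices of `C` cannot be separated by
`d`, so connectedness puts all of `C` on one side; `u` follows because it meets `h₀`. -/
theorem one_sided {d : V} (hdU : d ∉ S.U) (hdC : d ∉ C) (hdu : d ≠ u) (hud : ¬ G.Adj u d) :
    (∀ c ∈ insert u C, S.Lt c d) ∨ (∀ c ∈ insert u C, S.Lt d c) := by
  have hX : ∀ c ∈ insert u C, S.Lt c d ∨ S.Lt d c := by
    intro c hc
    by_contra h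
    rw [not_or] at h
    exact hdU (crossing hC hu h₀C hh hc hdC hdu hud h.1 h.2).1
  have hu0 : S.Lt u d ↔ S.Lt h₀ d := by
    constructor
    · intro h
      exact (hX h₀ (Or.inr h₀C)).resolve_right fun h' => hh.2.1 (h.trans h')
    · intro h
      exact (hX u (Or.inl rfl)).resolve_right fun h' => hh.2.2.1 (h.trans h')
  by_cases h0 : S.Lt h₀ d
  · left
    have : {c | c ∈ C ∧ S.Lt c d} = C := by
      refine hC.connected _ (fun c hc => hc.1) ⟨h₀, h₀C, h0⟩ ?_
      rintro a ⟨ha, had⟩ b hb hab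
      refine ⟨hb, (hX b (Or.inr hb)).resolve_right fun h' => ?_⟩
      exact S.not_lt_of_adj hab (had.trans h')
    rintro c (rfl | hc)
    · exact hu0.2 h0
    · rw [← this] at hc; exact hc.2
  · right
    have : {c | c ∈ C ∧ S.Lt d c} = C := by
      refine hC.connected _ (fun c hc => hc.1)
        ⟨h₀, h₀C, (hX h₀ (Or.inr h₀C)).resolve_left h0⟩ ?_
      rintro a ⟨ha, had⟩ b hb hab
      refine ⟨hb, (hX b (Or.inr hb)).resolve_left fun h' => ?_⟩
      exact S.not_lt_of_adj hab.symm (h'.trans had)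
    rintro c (rfl | hc)
    · exact (hX _ (Or.inl rfl)).resolve_left fun h => h0 (hu0.1 h)
    · rw [← this] at hc; exact hc.2

end Component

/-! ### Consequences of the right border property at the right end of `C`. -/

section RightBorder

variable {S} {u h₀ g f : V} {C : Set V} (hC : IsCoveringComponent G u C) (hu : u ∈ S.U)
  (h₀C : h₀ ∈ C) (hh : S.Hovers h₀ u) (hgen : S.Generic)
  (hborder : ∀ y, G.Adj u y → ∀ c ∈ C, ¬ S.Lt y c)
  (hg : g ∈ insert u C) (hgmax : ∀ c ∈ insert u C, S.l c ≤ S.l g)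
  (hf : f ∈ insert u C) (hfmax : ∀ c ∈ insert u C, S.L c ≤ S.L f)

include hu in
theorem le_of_adj {y : V} (hy : G.Adj u y) : S.l u ≤ S.l y + S.w y ∧ S.L y ≤ S.L u :=
  S.le_of_slope_lt (S.w_eq_zero u hu) (S.not_lt_of_adj hy) (S.not_lt_of_adj hy.symm)
    (S.slope_lt_of_adj hu hy)

include hC hu hborder hg in
/-- A neighbour of `u` that does not reach the lower end of `C` is met by the right-most lower
vertex of `C` on the upper line. -/
theorem upper_le_of_lower_lt {y : V} (hy : G.Adj u y) (h : S.l y + S.w y < S.l g) :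
    g ∈ C ∧ S.L g ≤ S.L y + S.w y := by
  have hgC : g ∈ C := by
    rcases hg with rfl | hg
    · exact absurd h (not_lt.2 (le_of_adj hu hy).1)
    · exact hg
  exact ⟨hgC, not_lt.1 fun h' => hborder y hy g hgC ⟨h, h'⟩⟩

-- This keeps `y` from needing an extension past another neighbour of `u`. Otherwise `g` would cross
-- `u` with smaller slope: a bounded `g` would then be adjacent to `u`, and an unbounded `g` would
-- be isolated in `C`, hence equal to `h₀`, whose slope is larger.
include hC hu h₀C hh hborder hg in
theorem not_lt_of_lower_lt {y z : V} (hy : G.Adj u y) (hz : G.Adj u z)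
    (h : S.l y + S.w y < S.l g) : ¬ S.Lt y z := by
  intro hyz
  obtain ⟨hgC, hgy⟩ := upper_le_of_lower_lt hC hu hborder hg hy h
  have h1 := (le_of_adj hu hy).1
  have h2 := (le_of_adj hu hz).2
  have h3 := hyz.2
  have hw := S.w_eq_zero u hu
  have hug : ¬ S.Lt u g := fun h => by linarith [h.2]
  have hgu : ¬ S.Lt g u := fun h => by linarith [h.1, S.w_nonneg g]
  have hs : S.slope g < S.slope u := by simp only [slope]; linarith
  by_cases hgU : g ∈ S.U
  · have hsing : ({g} : Set V) = C := by
      refine hC.connected {g} (by simpa using hgC) ⟨g, rfl⟩ ?_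
      rintro a rfl b hb hab
      exact absurd (S.adj_of_slope_lt hgU hgu hug hs hab) (hC.not_adj b hb)
    obtain rfl : h₀ = g := by simpa [← hsing] using h₀C
    exact lt_asymm hs hh.2.2.2
  · exact hC.not_adj g hgC ((S.adj_mixed u g hu hgU).2 ⟨⟨hug, hgu⟩, hs⟩)

include hC hu h₀C hh hborder hg in
/-- Between a neighbour of `u` and the lower end of `C` there is no unbounded vertex that leans
further to the right than the neighbour and lies outside of `C`. -/
theorem not_lower_lt_of_unbounded {y d : V} (hy : G.Adj u y) (hdU : d ∈ S.U) (hdC : d ∉ C)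
    (hdu : d ≠ u) (hud : ¬ G.Adj u d) (hyd : S.Lt y d) : ¬ S.l d < S.l g := by
  intro h
  have hd := S.w_eq_zero d hdU
  obtain ⟨hgC, hgy⟩ := upper_le_of_lower_lt hC hu hborder hg hy (hyd.1.trans h)
  -- Here `d` starts left of `g` below and ends right of it above, so it crosses `g` with larger
  -- slope, contrary to `crossing`.
  have h1 : ¬ S.Lt g d := fun h' => by linarith [h'.1, S.w_nonneg g]
  have h2 : ¬ S.Lt d g := fun h' => by linarith [h'.2, hyd.2]
  have := (crossing hC hu h₀C hh hg hdC hdu hud h1 h2).2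
  simp only [slope] at this
  linarith [hyd.2]

-- In the first two cases `d` avoids the segment from `l g` to `L f`; in the third a meeting is
-- harmless, since the smaller slope of `d` prevents adjacency. The remaining position would cross
-- `g` with larger slope.
include hC hu h₀C hh hgen hg hgmax hf hfmax in
theorem unbounded_position {d : V} (hdU : d ∈ S.U) (hdC : d ∉ C) (hdu : d ≠ u)
    (hud : ¬ G.Adj u d) : (S.l d < S.l g ∧ S.L d < S.L f) ∨ (S.l g < S.l d ∧ S.L f < S.L d) ∨
      S.slope d < S.L f - S.l g := by
  have hd := S.w_eq_zero d hdU
  have hdne : ∀ c ∈ insert u C, d ≠ c := by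
    rintro c (rfl | hc) rfl
    · exact hdu rfl
    · exact hdC hc
  have hl := (hgen d g (hdne g hg)).1
  have hL := (hgen d f (hdne f hf)).2.2.1
  simp only [slope]
  rcases lt_or_gt_of_ne hl with hl | hl <;> rcases lt_or_gt_of_ne hL with hL | hL
  · exact Or.inl ⟨hl, hL⟩
  · exfalso
    have := hfmax g hg
    have h1 : ¬ S.Lt g d := fun h' => by linarith [h'.1, S.w_nonneg g]
    have h2 : ¬ S.Lt d g := fun h' => by linarith [h'.2]
    have := (crossing hC hu h₀C hh hg hdC hdu hud h1 h2).2
    simp only [slope] at this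
    linarith
  · right; right; linarith
  · exact Or.inr (Or.inl ⟨hl, hL⟩)

end RightBorder

end StripRep

end TolGraph

/-! ### Moving `u` to the right end of `C`. -/

namespace TolGraph

namespace StripRep

variable {V : Type*} {G : SimpleGraph V}

-- The factor 2 at the upper end makes the slope `q - p + ε` vary with `ε`, so finitely many slopes
-- can be avoided.
open Filter Topology in
theorem exists_small_shift [Finite V] (l L w : V → ℝ) (p q : ℝ) :
    ∃ ε : ℝ, 0 < ε ∧ ∀ v, (p < l v → p + ε < l v) ∧ (p < l v + w v → p + ε < l v + w v) ∧
      (q < L v → q + 2 * ε < L v) ∧ (q < L v + w v → q + 2 * ε < L v + w v) ∧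
      L v - l v ≠ q + 2 * ε - (p + ε) := by
  have line : ∀ x y k : ℝ, 0 < k → ∀ᶠ ε in 𝓝[>] (0 : ℝ), x < y → x + k * ε < y := by
    intro x y k hk
    by_cases hxy : x < y
    · have : 0 < (y - x) / k := div_pos (by linarith) hk
      filter_upwards [Ioo_mem_nhdsGT this] with ε hε _
      have := (lt_div_iff₀ hk).1 hε.2
      linarith
    · simp [hxy]
  have slope : ∀ z : ℝ, ∀ᶠ ε in 𝓝[>] (0 : ℝ), z ≠ q + 2 * ε - (p + ε) := by
    intro z
    by_cases hz : q - p < z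
    · filter_upwards [line _ _ 1 one_pos] with ε hε h
      have := hε hz
      linarith
    · filter_upwards [self_mem_nhdsWithin] with ε hε h
      have hε : 0 < ε := hε
      linarith
  have : ∀ᶠ ε in 𝓝[>] (0 : ℝ), 0 < ε ∧ ∀ v, (p < l v → p + ε < l v) ∧
      (p < l v + w v → p + ε < l v + w v) ∧
      (q < L v → q + 2 * ε < L v) ∧ (q < L v + w v → q + 2 * ε < L v + w v) ∧
      L v - l v ≠ q + 2 * ε - (p + ε) := by
    refine Eventually.and (show ∀ᶠ ε in 𝓝[>] (0 : ℝ), 0 < ε from self_mem_nhdsWithin) ?_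
    rw [eventually_all]
    intro v
    refine Eventually.and ?_ (Eventually.and ?_ ((line _ _ 2 two_pos).and
      ((line _ _ 2 two_pos).and (slope _))))
    · simpa using line p (l v) 1 one_pos
    · simpa using line p (l v + w v) 1 one_pos
  exact this.exists

/-- If the right border property holds, then `u` can be moved to the right end of `C` as a bounded
vertex: the vertices of `C` are cut off on the right, and the neighbours of `u` are extended to the
right until they reach the new position of `u`. -/
theorem exists_of_right_border [Finite V] (S : StripRep G) {u h₀ : V} {C : Set V}
    (hC : IsCoveringComponent G u C) (hu : u ∈ S.U) (h₀C : h₀ ∈ C) (hh : S.Hovers h₀ u)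
    (hgen : S.Generic) (hborder : ∀ y, G.Adj u y → ∀ c ∈ C, ¬ S.Lt y c) :
    ∃ S' : StripRep G, S'.U = S.U \ {u} := by
  classical
  obtain ⟨g, hg, hgmax⟩ := Set.exists_max_image (insert u C) S.l (Set.toFinite _)
    ⟨u, Set.mem_insert _ _⟩
  obtain ⟨f, hf, hfmax⟩ := Set.exists_max_image (insert u C) S.L (Set.toFinite _)
    ⟨u, Set.mem_insert _ _⟩
  obtain ⟨ε, hε, hgap⟩ := exists_small_shift S.l S.L S.w (S.l g) (S.L f)
  have hul : S.l u ≤ S.l g := hgmax u (Set.mem_insert _ _)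
  have huL : S.L u ≤ S.L f := hfmax u (Set.mem_insert _ _)
  have huw := S.w_eq_zero u hu
  have hNC : ∀ y, G.Adj u y → y ∉ insert u C := by
    rintro y hy (rfl | hc)
    · exact G.irrefl hy
    · exact hC.not_adj y hc hy
  -- the new coordinates
  let cut : V → ℝ := fun c => max 0 (max (S.l c + S.w c - S.l g) (S.L c + S.w c - S.L f))
  -- The minimum stops the extension once one of the two ends is level with the new `u`, which
  -- suffices to meet it.
  let ext : V → ℝ := fun y => max 0 (min (S.l g + ε - (S.l y + S.w y))
    (S.L f + 2 * ε - (S.L y + S.w y)))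
  let l' : V → ℝ := fun v => if v = u then S.l g + ε else S.l v
  let L' : V → ℝ := fun v => if v = u then S.L f + 2 * ε else S.L v
  let w' : V → ℝ := fun v => if v = u then 0 else if v ∈ C then S.w v - cut v else
    if G.Adj u v then S.w v + ext v else S.w v
  have l'_u : l' u = S.l g + ε := if_pos rfl
  have L'_u : L' u = S.L f + 2 * ε := if_pos rfl
  have w'_u : w' u = 0 := if_pos rfl
  have l'_ne : ∀ v, v ≠ u → l' v = S.l v := fun v hv => if_neg hv
  have L'_ne : ∀ v, v ≠ u → L' v = S.L v := fun v hv => if_neg hv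
  have w'_C : ∀ v, v ∈ C → w' v = S.w v - cut v := fun v hv => by
    simp only [w', hC.ne v hv, hv, if_true, if_false]
  have w'_N : ∀ v, G.Adj u v → w' v = S.w v + ext v := fun v hv => by
    have h1 : v ≠ u := hv.ne'
    have h2 : v ∉ C := fun h => hC.not_adj v h hv
    simp only [w', h1, h2, hv, if_true, if_false]
  have w'_D : ∀ v, v ≠ u → v ∉ C → ¬ G.Adj u v → w' v = S.w v := fun v h1 h2 h3 => by
    simp only [w', h1, h2, h3, if_false]
  have cut_nonneg : ∀ c, 0 ≤ cut c := fun c => le_max_left _ _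
  have ext_nonneg : ∀ c, 0 ≤ ext c := fun c => le_max_left _ _
  have cut_le : ∀ c ∈ C, cut c ≤ S.w c := by
    intro c hc
    have h1 := hgmax c (Or.inr hc)
    have h2 := hfmax c (Or.inr hc)
    exact max_le (S.w_nonneg c) (max_le (by linarith) (by linarith))
  have cut_lower : ∀ c, S.l c + S.w c - cut c ≤ S.l g := by
    intro c
    have : S.l c + S.w c - S.l g ≤ cut c := (le_max_left _ _).trans (le_max_right _ _)
    linarith
  have cut_upper : ∀ c, S.L c + S.w c - cut c ≤ S.L f := by
    intro c
    have : S.L c + S.w c - S.L f ≤ cut c := (le_max_right _ _).trans (le_max_right _ _)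
    linarith
  have cut_cases : ∀ c, cut c = 0 ∨ 0 < cut c ∧
      (S.l c + S.w c - cut c = S.l g ∨ S.L c + S.w c - cut c = S.L f) := by
    intro c
    rcases (cut_nonneg c).eq_or_lt with h | h
    · exact Or.inl h.symm
    · refine Or.inr ⟨h, ?_⟩
      have h1 : cut c = max (S.l c + S.w c - S.l g) (S.L c + S.w c - S.L f) := by
        refine max_eq_right (le_of_not_ge fun h' => ?_)
        have : cut c = 0 := max_eq_left h'
        linarith
      rcases max_choice (S.l c + S.w c - S.l g) (S.L c + S.w c - S.L f) with h2 | h2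
      · left; linarith
      · right; linarith
  -- the extension of a neighbour of `u` that does not yet reach the new position of `u`
  have ext_cases : ∀ y, G.Adj u y → ext y = 0 ∨ (S.l y + S.w y < S.l g ∧ S.L y + S.w y < S.L f ∧
      S.l y + S.w y + ext y ≤ S.l g + ε ∧ S.L y + S.w y + ext y ≤ S.L f + 2 * ε) := by
    intro y hy
    rcases (ext_nonneg y).eq_or_lt with h | h
    · exact Or.inl h.symm
    · right
      have h1 : ext y = min (S.l g + ε - (S.l y + S.w y)) (S.L f + 2 * ε - (S.L y + S.w y)) := by
        refine max_eq_right (le_of_not_ge fun h' => ?_)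
        have : ext y = 0 := max_eq_left h'
        linarith
      have h2 := h1.le.trans (min_le_left _ _)
      have h3 := h1.le.trans (min_le_right _ _)
      have hyg : g ≠ y := fun h => hNC y hy (h ▸ hg)
      have hyf : f ≠ y := fun h => hNC y hy (h ▸ hf)
      -- A right end beyond `l g` (or `L f`) is already beyond the shifted point, leaving nothing to
      -- extend; genericity excludes equality.
      refine ⟨lt_of_le_of_ne (not_lt.1 fun h' => ?_) (hgen g y hyg).2.1.symm,
        lt_of_le_of_ne (not_lt.1 fun h' => ?_) (hgen f y hyf).2.2.2.symm,
        by linarith, by linarith⟩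
      · linarith [(hgap y).2.1 h']
      · linarith [(hgap y).2.2.2.1 h']
  have ext_reaches : ∀ y, S.l g + ε ≤ S.l y + S.w y + ext y ∨
      S.L f + 2 * ε ≤ S.L y + S.w y + ext y := by
    intro y
    have h : min (S.l g + ε - (S.l y + S.w y)) (S.L f + 2 * ε - (S.L y + S.w y)) ≤ ext y :=
      le_max_right _ _
    rcases min_le_iff.1 h with h | h
    · left; linarith
    · right; linarith
  -- adjacent vertices still meet
  have adj_meets : ∀ a b, a ≠ u → b ≠ u → G.Adj a b → ¬ StripLt l' L' w' a b := by
    rintro a b hau hbu hab ⟨h1, h2⟩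
    rw [l'_ne a hau, l'_ne b hbu] at h1
    rw [L'_ne a hau, L'_ne b hbu] at h2
    have hold := S.not_lt_of_adj hab
    by_cases haC : a ∈ C
    · rw [w'_C a haC] at h1 h2
      rcases cut_cases a with h0 | ⟨hpos, h0⟩
      · exact hold ⟨by linarith, by linarith⟩
      by_cases hbC : b ∈ C
      · have := hgmax b (Or.inr hbC)
        have := hfmax b (Or.inr hbC)
        rcases h0 with h0 | h0 <;> linarith
      have hbN : G.Adj u b := by
        by_contra h
        exact hbC (hC.closed a haC b hbu h hab)
      have hbL := (le_of_adj hu hbN).2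
      rcases h0 with h0 | h0
      -- A bounded `a` meeting `u` without adjacency has larger slope than `u`. Cut at `l g ≥ l u`,
      -- its upper right end is therefore still beyond `L u ≥ L b`.
      · have haw : 0 < S.w a := hpos.trans_le (cut_le a haC)
        have haU : a ∉ S.U := fun h => haw.ne' (S.w_eq_zero a h)
        have hnau : ¬ S.Lt a u := fun h => by linarith [h.1]
        by_cases hua : S.Lt u a
        · linarith [hua.2, cut_le a haC]
        · have := S.slope_lt_of_not_adj hu haU hua hnau (hC.not_adj a haC)
          simp only [slope] at this
          linarith
      · linarith
    · have hw : S.w a ≤ w' a := by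
        by_cases haN : G.Adj u a
        · rw [w'_N a haN]; linarith [ext_nonneg a]
        · rw [w'_D a hau haC haN]
      exact hold ⟨by linarith, by linarith⟩
  -- disjoint nonadjacent vertices stay disjoint
  have lt_of_lt : ∀ a b, a ≠ u → b ≠ u → ¬ G.Adj a b → S.Lt a b →
      StripLt l' L' w' a b ∨ (G.Adj u a ∧ b ∈ S.U ∧ S.slope b < S.slope a) := by
    intro a b hau hbu hab hlt
    have hne : a ≠ b := by
      rintro rfl
      linarith [hlt.1, S.w_nonneg a]
    simp only [StripLt, l'_ne a hau, l'_ne b hbu, L'_ne a hau, L'_ne b hbu]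
    by_cases haN : G.Adj u a
    · rw [w'_N a haN]
      rcases ext_cases a haN with h0 | ⟨h1, h2, h3, h4⟩
      · left
        rw [h0, add_zero]
        exact hlt
      by_cases hbC : b ∈ C
      · exact absurd hlt (hborder a haN b hbC)
      by_cases hbN : G.Adj u b
      · exact absurd hlt (not_lt_of_lower_lt hC hu h₀C hh hborder hg haN hbN h1)
      by_cases hbU : b ∈ S.U
      -- Running into a segment `b` of smaller slope creates no adjacency. If `b` has larger slope,
      -- then `l b` lies beyond `l g + ε`, where the extension stops below, and the slopes keep the
      -- upper ends apart as well.
      · rw [or_iff_not_imp_right]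
        intro hslope
        have hs : S.slope a < S.slope b :=
          lt_of_le_of_ne (not_lt.1 fun h => hslope ⟨haN, hbU, h⟩) (S.slope_ne a b hne)
        have hlb := not_lower_lt_of_unbounded hC hu h₀C hh hborder hg haN hbU hbC hbu hbN hlt
        have hbg : b ≠ g := by
          rintro rfl
          rcases hg with rfl | hg
          · exact hbu rfl
          · exact hbC hg
        have hlb' := lt_of_le_of_ne (not_lt.1 hlb) (hgen b g hbg).1.symm
        have h5 := (hgap b).1 hlb'
        simp only [slope] at hs
        exact ⟨by linarith, by linarith⟩
      · left
        rcases one_sided hC hu h₀C hh hbU hbC hbu hbN with h | h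
        · have h5 := (h g hg).1
          have h6 := (h f hf).2
          have h7 := (hgap b).1 (by linarith [S.w_nonneg g])
          have h8 := (hgap b).2.2.1 (by linarith [S.w_nonneg f])
          exact ⟨by linarith, by linarith⟩
        · exact absurd (hlt.trans (h u (Set.mem_insert _ _))) (S.not_lt_of_adj haN.symm)
    · left
      have hw : w' a ≤ S.w a := by
        by_cases haC : a ∈ C
        · rw [w'_C a haC]; linarith [cut_nonneg a]
        · rw [w'_D a hau haC haN]
      exact ⟨by linarith [hlt.1], by linarith [hlt.2]⟩
  -- the new position of `u`
  have u_adj : ∀ v, G.Adj u v → ¬ StripLt l' L' w' u v ∧ ¬ StripLt l' L' w' v u := by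
    intro v hv
    simp only [StripLt, l'_u, L'_u, w'_u, l'_ne v hv.ne', L'_ne v hv.ne', w'_N v hv]
    refine ⟨fun h => ?_, fun h => ?_⟩
    · linarith [h.2, (le_of_adj hu hv).2]
    · rcases ext_reaches v with h' | h' <;> linarith [h.1, h.2]
  have u_not_adj : ∀ v, v ≠ u → ¬ G.Adj u v → StripLt l' L' w' u v ∨ StripLt l' L' w' v u ∨
      (v ∈ S.U ∧ S.slope v < S.L f + 2 * ε - (S.l g + ε)) := by
    intro v hvu hv
    simp only [StripLt, l'_u, L'_u, w'_u, l'_ne v hvu, L'_ne v hvu]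
    by_cases hvC : v ∈ C
    · rw [w'_C v hvC]
      have := cut_lower v
      have := cut_upper v
      exact Or.inr (Or.inl ⟨by linarith, by linarith⟩)
    rw [w'_D v hvu hvC hv]
    by_cases hvU : v ∈ S.U
    · have hw := S.w_eq_zero v hvU
      rcases unbounded_position hC hu h₀C hh hgen hg hgmax hf hfmax hvU hvC hvu hv with
        h | h | h
      · exact Or.inr (Or.inl ⟨by linarith, by linarith⟩)
      · have h1 := (hgap v).1 h.1
        have h2 := (hgap v).2.2.1 h.2
        exact Or.inl ⟨by linarith, by linarith⟩
      · exact Or.inr (Or.inr ⟨hvU, by linarith⟩)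
    · rcases one_sided hC hu h₀C hh hvU hvC hvu hv with h | h
      · have h5 := (h g hg).1
        have h6 := (h f hf).2
        have h7 := (hgap v).1 (by linarith [S.w_nonneg g])
        have h8 := (hgap v).2.2.1 (by linarith [S.w_nonneg f])
        exact Or.inl ⟨by linarith, by linarith⟩
      · have h5 := (h g hg).1
        have h6 := (h f hf).2
        exact Or.inr (Or.inl ⟨by linarith, by linarith⟩)
  have slope' : ∀ v, v ≠ u → L' v - l' v = S.slope v := fun v hv => by
    rw [l'_ne v hv, L'_ne v hv, slope]
  have u_bounded : ∀ v, v ≠ u → v ∉ S.U →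
      (G.Adj u v ↔ ¬ StripLt l' L' w' u v ∧ ¬ StripLt l' L' w' v u) := by
    intro v hvu hvU
    refine ⟨u_adj v, fun ⟨h1, h2⟩ => ?_⟩
    by_contra hv
    rcases u_not_adj v hvu hv with h | h | h
    · exact h1 h
    · exact h2 h
    · exact hvU h.1
  refine ⟨⟨l', L', w', S.U \ {u}, fun v => ?_, fun v hv => ?_, fun a b ha hb hab => ?_,
    fun x b hx hb => ?_, fun x y hx hy => S.indep x y hx.1 hy.1, fun a b hab => ?_⟩, rfl⟩
  · by_cases hvu : v = u
    · subst hvu; exact w'_u.ge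
    by_cases hvC : v ∈ C
    · rw [w'_C v hvC]; linarith [cut_le v hvC]
    by_cases hvN : G.Adj u v
    · rw [w'_N v hvN]; linarith [ext_nonneg v, S.w_nonneg v]
    · rw [w'_D v hvu hvC hvN]; exact S.w_nonneg v
  · have hw := S.w_eq_zero v hv.1
    by_cases hvC : v ∈ C
    · rw [w'_C v hvC]; linarith [cut_le v hvC, cut_nonneg v]
    · rw [w'_D v hv.2 hvC (S.indep u v hu hv.1), hw]
  · simp only [Set.mem_sdiff, Set.mem_singleton_iff, not_and_or, not_not] at ha hb
    by_cases hau : a = u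
    · subst hau
      exact u_bounded b hab.symm (hb.resolve_right hab.symm)
    by_cases hbu : b = u
    · subst hbu
      rw [G.adj_comm, and_comm]
      exact u_bounded a hab (ha.resolve_right hau)
    have haU := ha.resolve_right hau
    have hbU := hb.resolve_right hbu
    refine ⟨fun h => ⟨adj_meets a b hau hbu h, adj_meets b a hbu hau h.symm⟩,
      fun ⟨h1, h2⟩ => ?_⟩
    refine (S.adj_bounded a b haU hbU hab).2 ⟨fun h => ?_, fun h => ?_⟩
    · rcases lt_of_lt a b hau hbu (fun h' => S.not_lt_of_adj h' h) h with h' | h'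
      · exact h1 h'
      · exact hbU h'.2.1
    · rcases lt_of_lt b a hbu hau (fun h' => S.not_lt_of_adj h' h) h with h' | h'
      · exact h2 h'
      · exact haU h'.2.1
  · simp only [Set.mem_sdiff, Set.mem_singleton_iff, not_and_or, not_not] at hx hb
    obtain ⟨hxU, hxu⟩ := hx
    by_cases hbu : b = u
    · subst hbu
      refine iff_of_false (S.indep x b hxU hu) fun ⟨⟨h1, h2⟩, h3⟩ => ?_
      rcases u_not_adj x hxu (S.indep b x hu hxU) with h | h | h
      · exact h2 h
      · exact h1 h
      · rw [slope' x hxu, l'_u, L'_u] at h3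
        exact lt_asymm h.2 h3
    have hbU := hb.resolve_right hbu
    rw [slope' x hxu, slope' b hbu]
    refine ⟨fun h => ⟨⟨adj_meets x b hxu hbu h, adj_meets b x hbu hxu h.symm⟩,
      S.slope_lt_of_adj hxU h⟩, fun ⟨⟨h1, h2⟩, h3⟩ => ?_⟩
    refine (S.adj_mixed x b hxU hbU).2 ⟨⟨fun h => ?_, fun h => ?_⟩, h3⟩
    · rcases lt_of_lt x b hxu hbu (fun h' => S.not_lt_of_adj h' h) h with h' | h'
      · exact h1 h'
      · exact hbU h'.2.1
    · rcases lt_of_lt b x hbu hxu (fun h' => S.not_lt_of_adj h' h) h with h' | h'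
      · exact h2 h'
      · exact lt_asymm h3 h'.2.2
  · by_cases hau : a = u
    · subst hau
      rw [slope' b hab.symm, l'_u, L'_u]
      exact fun h => (hgap b).2.2.2.2 h.symm
    by_cases hbu : b = u
    · subst hbu
      rw [slope' a hab, l'_u, L'_u]
      exact (hgap a).2.2.2.2
    rw [slope' a hau, slope' b hbu]
    exact S.slope_ne a b hab

end StripRep

end TolGraph

namespace TolGraph

variable {V : Type*} {G : SimpleGraph V}

/-! ### Bounded tolerance graphs and parallelograms -/

theorem volume_real_Icc_inter (a b c d : ℝ) :
    volume.real (Set.Icc a b ∩ Set.Icc c d) = max (min b d - max a c) 0 := by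
  rw [Set.Icc_inter_Icc, Real.volume_real_Icc]

/-- The interval `[a, b]` with tolerance `t` becomes the parallelogram with lower side `[a, b - t]`
and upper side `[a + t, b]`. Then `u` lies left of `v` exactly when `b u - a v` is below both
tolerances. -/
theorem IsBoundedTolerance.exists_strips (h : IsBoundedTolerance G) :
    ∃ l L w : V → ℝ, (∀ v, 0 ≤ w v) ∧
      ∀ a b, a ≠ b → (G.Adj a b ↔ ¬ StripLt l L w a b ∧ ¬ StripLt l L w b a) := by
  obtain ⟨I, hI⟩ := h
  refine ⟨I.a, fun v => I.a v + I.t v, fun v => I.b v - I.a v - I.t v,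
    fun v => by linarith [hI v], fun u v huv => ?_⟩
  rw [I.adj_iff u v huv, volume_real_Icc_inter]
  have hu := I.pos u
  have hv := I.pos v
  have hm : 0 < min (I.t u) (I.t v) := lt_min hu hv
  have hu' := hI u
  have hv' := hI v
  rw [le_max_iff, or_iff_left (not_le.2 hm)]
  simp only [StripLt]
  constructor
  · intro h
    have h1 := min_le_left (I.b u) (I.b v)
    have h2 := min_le_right (I.b u) (I.b v)
    have h3 := le_max_left (I.a u) (I.a v)
    have h4 := le_max_right (I.a u) (I.a v)
    constructor <;> rintro ⟨h5, h6⟩ <;> rcases min_choice (I.t u) (I.t v) with h7 | h7 <;>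
      linarith
  · rintro ⟨h1, h2⟩
    rw [not_and_or, not_lt, not_lt] at h1 h2
    have h3 := min_le_left (I.t u) (I.t v)
    have h4 := min_le_right (I.t u) (I.t v)
    have h5 : min (I.t u) (I.t v) ≤ I.b u - I.a v := by rcases h1 with h1 | h1 <;> linarith
    have h6 : min (I.t u) (I.t v) ≤ I.b v - I.a u := by rcases h2 with h2 | h2 <;> linarith
    rcases min_choice (I.b u) (I.b v) with h7 | h7 <;>
      rcases max_choice (I.a u) (I.a v) with h8 | h8 <;> rw [h7, h8] <;> linarith

/-- The tolerance is read off as the slope. Translating the whole upper line by `K + 1` makes all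
slopes positive and changes no intersection. -/
theorem isBoundedTolerance_of_strips [Finite V] (l L w : V → ℝ) (hw : ∀ v, 0 ≤ w v)
    (h : ∀ a b, a ≠ b → (G.Adj a b ↔ ¬ StripLt l L w a b ∧ ¬ StripLt l L w b a)) :
    IsBoundedTolerance G := by
  obtain ⟨K, hK⟩ := (Set.finite_range fun v => l v - L v).bddAbove
  have hK' : ∀ v, l v - L v ≤ K := fun v => hK ⟨v, rfl⟩
  refine ⟨⟨l, fun v => L v + w v + (K + 1), fun v => L v - l v + (K + 1), fun v => ?_, fun v => ?_,
    fun u v huv => ?_⟩, fun v => ?_⟩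
  · linarith [hK' v, hw v]
  · linarith [hK' v]
  · rw [h u v huv, volume_real_Icc_inter]
    have hu := hK' u
    have hv := hK' v
    have hm : 0 < min (L u - l u + (K + 1)) (L v - l v + (K + 1)) :=
      lt_min (by linarith) (by linarith)
    have hu' := hw u
    have hv' := hw v
    rw [le_max_iff, or_iff_left (not_le.2 hm)]
    simp only [StripLt]
    constructor
    · rintro ⟨h1, h2⟩
      rw [not_and_or, not_lt, not_lt] at h1 h2
      have h3 := min_le_left (L u - l u + (K + 1)) (L v - l v + (K + 1))
      have h4 := min_le_right (L u - l u + (K + 1)) (L v - l v + (K + 1))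
      have h5 : min (L u - l u + (K + 1)) (L v - l v + (K + 1)) ≤ L u + w u + (K + 1) - l v := by
        rcases h1 with h1 | h1 <;> linarith
      have h6 : min (L u - l u + (K + 1)) (L v - l v + (K + 1)) ≤ L v + w v + (K + 1) - l u := by
        rcases h2 with h2 | h2 <;> linarith
      rcases min_choice (L u + w u + (K + 1)) (L v + w v + (K + 1)) with h7 | h7 <;>
        rcases max_choice (l u) (l v) with h8 | h8 <;> rw [h7, h8] <;> linarith
    · intro h
      have h1 := min_le_left (L u + w u + (K + 1)) (L v + w v + (K + 1))
      have h2 := min_le_right (L u + w u + (K + 1)) (L v + w v + (K + 1))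
      have h3 := le_max_left (l u) (l v)
      have h4 := le_max_right (l u) (l v)
      constructor <;> rintro ⟨h5, h6⟩ <;>
        rcases min_choice (L u - l u + (K + 1)) (L v - l v + (K + 1)) with h7 | h7 <;> linarith
  · dsimp only
    linarith [hw v]

/-! ### Inserting a vertex into a gap -/

theorem StripLt.trans {l L w : V → ℝ} (hw : ∀ v, 0 ≤ w v) {a b c : V} (h1 : StripLt l L w a b)
    (h2 : StripLt l L w b c) : StripLt l L w a c :=
  ⟨by linarith [h1.1, h2.1, hw b], by linarith [h1.2, h2.2, hw b]⟩

/-- If in a parallelogram representation of `G` without `u` the component `C` of `G \ N[u]` lies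
to the left of a covering vertex of `u` and contains another one, then `u` can be inserted. -/
theorem isBoundedTolerance_of_gap [Finite V] {u v₁ v₂ : V} {C : Set V} {l L w : V → ℝ}
    (hw : ∀ v, 0 ≤ w v)
    (h : ∀ a b, a ≠ u → b ≠ u → a ≠ b →
      (G.Adj a b ↔ ¬ StripLt l L w a b ∧ ¬ StripLt l L w b a))
    (hne : ∀ c ∈ C, c ≠ u) (hna : ∀ c ∈ C, ¬ G.Adj u c)
    (hside : ∀ d, d ≠ u → ¬ G.Adj u d → d ∉ C →
      (∀ c ∈ C, StripLt l L w c d) ∨ (∀ c ∈ C, StripLt l L w d c))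
    (hv₁ : v₁ ∈ C) (hcov₁ : ∀ y, G.Adj u y → G.Adj v₁ y)
    (hv₂u : v₂ ≠ u) (hcov₂ : ∀ y, G.Adj u y → G.Adj v₂ y)
    (hlt : ∀ c ∈ C, StripLt l L w c v₂) :
    IsBoundedTolerance G := by
  classical
  obtain ⟨g, hg, hgmax⟩ := Set.exists_max_image C (fun v => l v + w v) (Set.toFinite _) ⟨v₁, hv₁⟩
  obtain ⟨f, hf, hfmax⟩ := Set.exists_max_image C (fun v => L v + w v) (Set.toFinite _) ⟨v₁, hv₁⟩
  obtain ⟨ε, hε, hgap⟩ := StripRep.exists_small_shift l L w (l g + w g) (L f + w f)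
  let l' : V → ℝ := fun v => if v = u then l g + w g + ε else l v
  let L' : V → ℝ := fun v => if v = u then L f + w f + 2 * ε else L v
  let w' : V → ℝ := fun v => if v = u then 0 else w v
  have l'_u : l' u = l g + w g + ε := if_pos rfl
  have L'_u : L' u = L f + w f + 2 * ε := if_pos rfl
  have w'_u : w' u = 0 := if_pos rfl
  have l'_ne : ∀ v, v ≠ u → l' v = l v := fun v hv => if_neg hv
  have L'_ne : ∀ v, v ≠ u → L' v = L v := fun v hv => if_neg hv
  have w'_ne : ∀ v, v ≠ u → w' v = w v := fun v hv => if_neg hv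
  have key : ∀ v, v ≠ u → (G.Adj u v ↔ ¬ StripLt l' L' w' u v ∧ ¬ StripLt l' L' w' v u) := by
    intro v hv
    simp only [StripLt, l'_u, L'_u, w'_u, l'_ne v hv, L'_ne v hv, w'_ne v hv]
    constructor
    -- A neighbour of `u` meets both `v₁` in `C` and `v₂` beyond the gap, so it spans the segment
    -- placed in the gap.
    · intro hadj
      have h1 := (h v₁ v (hne _ hv₁) hv (hcov₁ v hadj).ne).1 (hcov₁ v hadj)
      have h2 := (h v₂ v hv₂u hv (hcov₂ v hadj).ne).1 (hcov₂ v hadj)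
      refine ⟨fun h3 => h1.1 ?_, fun h3 => h2.2 ?_⟩
      · have h4 := hgmax v₁ hv₁
        have h5 := hfmax v₁ hv₁
        exact ⟨by linarith [h3.1], by linarith [h3.2]⟩
      · have h4 := (hgap v₂).1 (hlt g hg).1
        have h5 := (hgap v₂).2.2.1 (hlt f hf).2
        exact ⟨by linarith [h3.1], by linarith [h3.2]⟩
    · rintro ⟨h1, h2⟩
      by_contra hadj
      by_cases hvC : v ∈ C
      · have h4 := hgmax v hvC
        have h5 := hfmax v hvC
        exact h2 ⟨by linarith, by linarith⟩
      rcases hside v hv hadj hvC with h3 | h3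
      · have h4 := (hgap v).1 (h3 g hg).1
        have h5 := (hgap v).2.2.1 (h3 f hf).2
        exact h1 ⟨by linarith, by linarith⟩
      · have h4 := (h3 g hg).1
        have h5 := (h3 f hf).2
        exact h2 ⟨by linarith [hw g], by linarith [hw f]⟩
  refine isBoundedTolerance_of_strips l' L' w' (fun v => ?_) fun a b hab => ?_
  · by_cases hv : v = u
    · subst hv; exact w'_u.ge
    · rw [w'_ne v hv]; exact hw v
  · by_cases hau : a = u
    · subst hau; exact key b hab.symm
    by_cases hbu : b = u
    · subst hbu
      rw [G.adj_comm, and_comm]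
      exact key a hab
    rw [h a b hau hbu hab]
    simp only [StripLt, l'_ne a hau, L'_ne a hau, w'_ne a hau, l'_ne b hbu, L'_ne b hbu,
      w'_ne b hbu]

/-- If `G` without `u` is a parallelogram graph but `G` is not, then all covering vertices of `u`
lie in the same component of `G \ N[u]`. -/
theorem mem_of_covering [Finite V] (hnot : ¬ IsBoundedTolerance G) {u v₁ v₂ : V} {C : Set V}
    {l L w : V → ℝ} (hw : ∀ v, 0 ≤ w v)
    (h : ∀ a b, a ≠ u → b ≠ u → a ≠ b →
      (G.Adj a b ↔ ¬ StripLt l L w a b ∧ ¬ StripLt l L w b a))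
    (hne : ∀ c ∈ C, c ≠ u) (hna : ∀ c ∈ C, ¬ G.Adj u c)
    (hclosed : ∀ c ∈ C, ∀ d, d ≠ u → ¬ G.Adj u d → G.Adj c d → d ∈ C)
    (hconn : ∀ P : Set V, P ⊆ C → P.Nonempty →
      (∀ a ∈ P, ∀ b ∈ C, G.Adj a b → b ∈ P) → P = C)
    (hv₁ : v₁ ∈ C) (hcov₁ : ∀ y, G.Adj u y → G.Adj v₁ y)
    (hv₂u : v₂ ≠ u) (hna₂ : ¬ G.Adj u v₂) (hcov₂ : ∀ y, G.Adj u y → G.Adj v₂ y) : v₂ ∈ C := by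
  by_contra hv₂
  have hside : ∀ d, d ≠ u → ¬ G.Adj u d → d ∉ C →
      (∀ c ∈ C, StripLt l L w c d) ∨ (∀ c ∈ C, StripLt l L w d c) := by
    intro d hdu hud hdC
    have hX : ∀ c ∈ C, StripLt l L w c d ∨ StripLt l L w d c := by
      intro c hc
      by_contra hcon
      rw [not_or] at hcon
      exact hdC (hclosed c hc d hdu hud
        ((h c d (hne c hc) hdu fun e => hdC (e ▸ hc)).2 hcon))
    by_cases hP : ∃ c ∈ C, StripLt l L w c d
    · left
      obtain ⟨c, hc, hcd⟩ := hP
      have : {c | c ∈ C ∧ StripLt l L w c d} = C := by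
        refine hconn _ (fun c hc => hc.1) ⟨c, hc, hcd⟩ ?_
        rintro a ⟨ha, had⟩ b hb hab
        refine ⟨hb, (hX b hb).resolve_right fun h' => ?_⟩
        exact ((h a b (hne a ha) (hne b hb) hab.ne).1 hab).1 (had.trans hw h')
      intro b hb
      rw [← this] at hb
      exact hb.2
    · right
      push Not at hP
      exact fun c hc => (hX c hc).resolve_left (hP c hc)
  rcases hside v₂ hv₂u hna₂ hv₂ with hlt | hlt
  · exact hnot (isBoundedTolerance_of_gap hw h hne hna hside hv₁ hcov₁ hv₂u hcov₂ hlt)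
  -- A mirror image suffices here: without unbounded vertices the sign of the slopes plays no role.
  · have hrefl : ∀ a b, StripLt (fun v => -(l v + w v)) (fun v => -(L v + w v)) w a b ↔
        StripLt l L w b a := by
      intro a b
      simp only [StripLt]
      constructor <;> rintro ⟨h1, h2⟩ <;> constructor <;> linarith
    refine hnot (isBoundedTolerance_of_gap (l := fun v => -(l v + w v))
      (L := fun v => -(L v + w v)) hw ?_ hne hna ?_ hv₁ hcov₁ hv₂u hcov₂ ?_)
    · intro a b ha hb hab
      rw [hrefl, hrefl, h a b ha hb hab, and_comm]
    · intro d hdu hud hdC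
      simp only [hrefl]
      exact (hside d hdu hud hdC).symm
    · simpa only [hrefl] using hlt

/-! ### Minimality -/

theorem IsTolerance.comap {W : Type*} (h : IsTolerance G) {φ : W → V}
    (hφ : Function.Injective φ) : IsTolerance (G.comap φ) := by
  obtain ⟨I⟩ := h
  exact ⟨⟨I.a ∘ φ, I.b ∘ φ, I.t ∘ φ, fun v => I.le _, fun v => I.pos _,
    fun u v huv => I.adj_iff _ _ (hφ.ne huv)⟩⟩

theorem IsTrapezoid.comap {W : Type*} (h : IsTrapezoid G) {φ : W → V}
    (hφ : Function.Injective φ) : IsTrapezoid (G.comap φ) := by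
  obtain ⟨T, hT⟩ := h
  exact ⟨T ∘ φ, fun u v huv => hT _ _ (hφ.ne huv)⟩

/-- Removing a vertex from a minimal graph leaves a parallelogram graph. -/
theorem exists_strips_of_minimal [Fintype V] (hTol : IsTolerance G) (hTrap : IsTrapezoid G)
    (hmin : ∀ (n : ℕ) (H : SimpleGraph (Fin n)), IsTolerance H → IsTrapezoid H →
      ¬ IsBoundedTolerance H → Fintype.card V ≤ n) (u : V) :
    ∃ l L w : V → ℝ, (∀ v, 0 ≤ w v) ∧ ∀ a b, a ≠ u → b ≠ u → a ≠ b →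
      (G.Adj a b ↔ ¬ StripLt l L w a b ∧ ¬ StripLt l L w b a) := by
  classical
  let e := Fintype.equivFin {v : V // v ≠ u}
  have hφ : Function.Injective fun i => (e.symm i : V) :=
    Subtype.val_injective.comp e.symm.injective
  have hB : IsBoundedTolerance (G.comap fun i => (e.symm i : V)) := by
    by_contra hB
    have h1 := hmin _ _ (hTol.comap hφ) (hTrap.comap hφ) hB
    have h2 : Fintype.card {v : V // v ≠ u} < Fintype.card V :=
      Fintype.card_subtype_lt (x := u) (by simp)
    omega
  obtain ⟨l, L, w, hw, h⟩ := hB.exists_strips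
  let ψ : (Fin (Fintype.card {v : V // v ≠ u}) → ℝ) → V → ℝ :=
    fun k v => if hv : v ≠ u then k (e ⟨v, hv⟩) else 0
  have hψ : ∀ k v (hv : v ≠ u), ψ k v = k (e ⟨v, hv⟩) := fun k v hv => dif_pos hv
  refine ⟨ψ l, ψ L, ψ w, fun v => ?_, fun a b ha hb hab => ?_⟩
  · dsimp only [ψ]
    split_ifs
    · exact hw _
    · exact le_rfl
  · have := h (e ⟨a, ha⟩) (e ⟨b, hb⟩) (by simpa using hab)
    simp only [SimpleGraph.comap_adj, Equiv.symm_apply_apply] at this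
    simpa only [StripLt, hψ _ _ ha, hψ _ _ hb] using this

/-! ### Components -/

/-- The component of `x` in `G \ N[u]`, as a set of vertices of `G`. -/
def nbhdComponent (G : SimpleGraph V) (u : V) (x : ↥(closedNbhd G u)ᶜ) : Set V :=
  Subtype.val '' {y : ↥(closedNbhd G u)ᶜ | (G.induce (closedNbhd G u)ᶜ).Reachable x y}

theorem mem_compl_closedNbhd {u v : V} : v ∈ (closedNbhd G u)ᶜ ↔ v ≠ u ∧ ¬ G.Adj u v := by
  simp [closedNbhd]

theorem nbhdComponent_closed {u : V} (x : ↥(closedNbhd G u)ᶜ) :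
    ∀ c ∈ nbhdComponent G u x, ∀ d, d ≠ u → ¬ G.Adj u d → G.Adj c d →
      d ∈ nbhdComponent G u x := by
  rintro _ ⟨c, hc, rfl⟩ d hdu hud hcd
  refine ⟨⟨d, mem_compl_closedNbhd.2 ⟨hdu, hud⟩⟩, ?_, rfl⟩
  exact SimpleGraph.Reachable.trans hc (SimpleGraph.Adj.reachable (by simpa using hcd))

theorem nbhdComponent_connected {u : V} (x : ↥(closedNbhd G u)ᶜ) (P : Set V)
    (hPC : P ⊆ nbhdComponent G u x) (hP : P.Nonempty)
    (h : ∀ a ∈ P, ∀ b ∈ nbhdComponent G u x, G.Adj a b → b ∈ P) :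
    P = nbhdComponent G u x := by
  refine Set.Subset.antisymm hPC ?_
  obtain ⟨p, hp⟩ := hP
  obtain ⟨p', hp', rfl⟩ := hPC hp
  rintro _ ⟨c, hc, rfl⟩
  obtain ⟨W⟩ : (G.induce (closedNbhd G u)ᶜ).Reachable p' c :=
    (SimpleGraph.Reachable.symm hp').trans hc
  clear hc
  induction W with
  | nil => exact hp
  | cons hadj W ih =>
    have hr := SimpleGraph.Reachable.trans hp' hadj.reachable
    exact ih hr (h _ hp _ ⟨_, hr, rfl⟩ (by simpa using hadj))

theorem nbhdComponent_subset_V0 {u : V} (x : ↥(closedNbhd G u)ᶜ)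
    (hx : ∀ y, G.Adj u y → G.Adj x y) : nbhdComponent G u x ⊆ V0 G u := by
  rintro _ ⟨c, hc, rfl⟩
  refine ⟨(G.induce (closedNbhd G u)ᶜ).connectedComponentMk x, ⟨x, rfl, x.2, hx⟩, c, ?_, rfl⟩
  exact SimpleGraph.ConnectedComponent.sound (SimpleGraph.Reachable.symm hc)

end TolGraph

/-! ### The main theorem. -/

theorem theorem1 {V : Type*} [Fintype V] (G : SimpleGraph V)
    (hTol : TolGraph.IsTolerance G) (hTrap : TolGraph.IsTrapezoid G)
    (hNotBdd : ¬ TolGraph.IsBoundedTolerance G)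
    (hmin : ∀ (n : ℕ) (H : SimpleGraph (Fin n)), TolGraph.IsTolerance H →
      TolGraph.IsTrapezoid H → ¬ TolGraph.IsBoundedTolerance H → Fintype.card V ≤ n)
    (R : TolGraph.ProjectionRep G) (k : ℕ) (hk : R.unbounded.ncard = k)
    (u : V) (hu : u ∈ R.unbounded)
    (hborder : TolGraph.RightBorder R u ∨ TolGraph.LeftBorder R u) :
    ∃ R' : TolGraph.ProjectionRep G, R'.unbounded.ncard + 1 = k := by
  open TolGraph in
  let S := StripRep.ofProjectionRep R
  have huS : u ∈ S.U := hu
  suffices h : ∃ S' : StripRep G, S'.U = S.U \ {u} by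
    obtain ⟨S', hS'⟩ := h
    obtain ⟨R', hR'⟩ := S'.exists_projectionRep
    refine ⟨R', ?_⟩
    rw [hR', hS', ← hk]
    exact Set.ncard_sdiff_singleton_add_one hu (Set.toFinite _)
  by_cases hhov : ∀ x, ¬ S.Hovers x u
  · exact S.exists_of_no_hovers huS hhov
  push Not at hhov
  obtain ⟨h₀, hh⟩ := hhov
  have hcov : ∀ y, G.Adj u y → G.Adj h₀ y := fun y hy =>
    S.adj_of_slope_lt huS hh.2.1 hh.2.2.1 hh.2.2.2 hy
  have h₀u : h₀ ≠ u := by rintro rfl; exact lt_irrefl _ hh.2.2.2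
  let x : ↥(closedNbhd G u)ᶜ := ⟨h₀, mem_compl_closedNbhd.2 ⟨h₀u, hh.1⟩⟩
  have h₀C : h₀ ∈ nbhdComponent G u x := ⟨x, SimpleGraph.Reachable.refl _, rfl⟩
  have hmem : ∀ c ∈ nbhdComponent G u x, c ≠ u ∧ ¬ G.Adj u c := by
    rintro _ ⟨c, -, rfl⟩
    exact mem_compl_closedNbhd.1 c.2
  obtain ⟨l, L, w, hw, hrep⟩ := exists_strips_of_minimal hTol hTrap hmin u
  have hC : IsCoveringComponent G u (nbhdComponent G u x) :=
    ⟨fun c hc => (hmem c hc).1, fun c hc => (hmem c hc).2, nbhdComponent_closed x,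
      nbhdComponent_connected x, fun v hvu hna hv =>
      mem_of_covering hNotBdd hw hrep (fun c hc => (hmem c hc).1) (fun c hc => (hmem c hc).2)
        (nbhdComponent_closed x) (nbhdComponent_connected x) h₀C hcov hvu hna hv⟩
  have hsub := nbhdComponent_subset_V0 x hcov
  rcases hborder with hb | hb
  · refine S.exists_of_right_border hC huS h₀C hh (StripRep.ofProjectionRep_generic R) ?_
    intro y hy c hc hlt
    exact hb ⟨y, hy, c, hsub hc, (StripRep.ofProjectionRep_lt R y c).1 hlt⟩
  -- Rotation exchanges left and right but keeps slopes, whereas a mirror image would reverse the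
  -- slope condition for unbounded vertices.
  · refine S.rotate.exists_of_right_border hC huS h₀C (S.rotate_hovers hh)
      (StripRep.ofProjectionRep_rotate_generic R) ?_
    intro y hy c hc hlt
    exact hb ⟨y, hy, c, hsub hc, (StripRep.ofProjectionRep_lt R c y).1
      ((S.rotate_lt y c).1 hlt)⟩
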